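/- **Proposition 1.2.** Let $(X,d)$ be a uniformly perfect metric space and let $E\subset X$ be an arbitrary subset. Then 1. $E$ is fat if and only if $E$ is quasisymmetrically thick; 2. $E$ is thin if and only if $E$ is quasisymmetrically null. Here $B(x,r)$ denotes the closed ball of centre $x$ and radius $r$, measures are Borel regular outer measures (so that they are defined on all subsets), and the notions are the following. * $X$ is *uniformly perfect* if it is not a singleton and there is a constant $D\ge 1$ such that, for all $x\in X$ and $r>0$, $X\setminus B(x,r)\neq\emptyset$ implies $B(x,r)\setminus B(x,r/D)\neq\emptyset$. * A measure $\mu$ on $X$ is *doubling* if there is a constant $C\ge 1$ such that $0<\mu(B(x,2r))\le C\mu(B(x,r))<\infty$ for all $x\in X$ and $r>0$. The set $E$ is *fat* if $\mu(E)>0$ for every doubling measure $\mu$ on $X$, and *thin* if $\mu(E)=0$ for every doubling measure $\mu$ on $X$. * A homeomorphism $f$ from $X$ onto a metric space $(Y,d_Y)$ is *quasisymmetric* if there is a homeomorphism $\eta\colon[0,\infty)\to[0,\infty)$ such that $$\frac{d_Y(f(x),f(y))}{d_Y(f(x),f(z))}\le\eta\left(\frac{d(x,y)}{d(x,z)}\right)$$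 for any three distinct points $x,y,z\in X$. * For $0<q<\infty$, a metric space $Y$ is *Ahlfors $q$-regular* if there are a measure $\nu$ on $Y$ and a constant $C\ge1$ such that $C^{-1}r^q\le\nu(B(y,r))\le Cr^q$ for all $y\in Y$ and all real $r$ with $0<r\le\operatorname{diam}Y$. * The set $E$ is *quasisymmetrically thick* if $\mathcal H^q(f(E))>0$, and *quasisymmetrically null* if $\mathcal H^q(f(E))=0$, whenever $0<q<\infty$ and $f$ is a quasisymmetric homeomorphism from $X$ onto an Ahlfors $q$-regular metric space $Y$ ($q$ may depend on $Y$). Here $\mathcal H^q$ is the $q$-dimensional Hausdorff measure on $Y$. -/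

import Mathlib

open MeasureTheory
open scoped NNReal ENNReal

universe u

/-- A metric space is uniformly perfect if it is not a singleton and there is a constant `D ≥ 1`
such that `X \ B(x, r) ≠ ∅` implies `B(x, r) \ B(x, r / D) ≠ ∅`, for all `x` and all `r > 0`;
balls are closed. -/
def IsUniformlyPerfect (X : Type u) [MetricSpace X] : Prop :=
  (¬ ∃ x : X, (Set.univ : Set X) = {x}) ∧
    ∃ D : ℝ, 1 ≤ D ∧ ∀ (x : X) (r : ℝ), 0 < r →
      (Set.univ \ Metric.closedBall x r).Nonempty →
        (Metric.closedBall x r \ Metric.closedBall x (r / D)).Nonempty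

/-- Doubling measures. A `Measure` on the Borel σ-algebra, evaluated on arbitrary sets by
`μ A = inf {μ B : A ⊆ B, B Borel}`, is the same thing as a Borel regular outer measure. -/
def IsDoublingMeasure {X : Type u} [MetricSpace X] [MeasurableSpace X] [BorelSpace X]
    (μ : Measure X) : Prop :=
  ∃ C : ℝ≥0, 1 ≤ C ∧ ∀ (x : X) (r : ℝ), 0 < r →
    0 < μ (Metric.closedBall x (2 * r)) ∧
      μ (Metric.closedBall x (2 * r)) ≤ C * μ (Metric.closedBall x r) ∧
      C * μ (Metric.closedBall x r) < ∞

/-- A set is fat if it has positive (outer) measure for all doubling measures. -/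
def IsFat {X : Type u} [MetricSpace X] [MeasurableSpace X] [BorelSpace X] (E : Set X) : Prop :=
  ∀ μ : Measure X, IsDoublingMeasure μ → 0 < μ E

/-- A set is thin if it has zero measure for all doubling measures. -/
def IsThin {X : Type u} [MetricSpace X] [MeasurableSpace X] [BorelSpace X] (E : Set X) : Prop :=
  ∀ μ : Measure X, IsDoublingMeasure μ → μ E = 0

/-- A homeomorphism `f` is quasisymmetric if there is a homeomorphism `η` of `[0, ∞)` onto itself
with `d(f x, f y) / d(f x, f z) ≤ η (d(x, y) / d(x, z))` for any three distinct points. -/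
def IsQuasisymmetric {X Y : Type u} [MetricSpace X] [MetricSpace Y] (f : X ≃ₜ Y) : Prop :=
  ∃ η : ℝ≥0 ≃ₜ ℝ≥0, ∀ x y z : X, x ≠ y → y ≠ z → x ≠ z →
    nndist (f x) (f y) / nndist (f x) (f z) ≤ η (nndist x y / nndist x z)

/-- A metric space `Y` is Ahlfors `q`-regular if it carries a Borel regular measure `ν` for which
`C⁻¹ r ^ q ≤ ν (B(y, r)) ≤ C r ^ q` for all closed balls with `0 < r ≤ diam Y` (`r` is
real, so that all radii `r > 0` are allowed when `Y` is unbounded). -/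
def IsAhlforsRegular (Y : Type u) [MetricSpace Y] [MeasurableSpace Y] [BorelSpace Y]
    (q : ℝ) : Prop :=
  ∃ (ν : Measure Y) (C : ℝ), 1 ≤ C ∧
    ∀ (y : Y) (r : ℝ), 0 < r → ENNReal.ofReal r ≤ Metric.ediam (Set.univ : Set Y) →
      ENNReal.ofReal (C⁻¹ * r ^ q) ≤ ν (Metric.closedBall y r) ∧
        ν (Metric.closedBall y r) ≤ ENNReal.ofReal (C * r ^ q)

/-- `E` is quasisymmetrically thick: `H^q (f E) > 0` for every quasisymmetric homeomorphism `f`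
of `X` onto an Ahlfors `q`-regular space `Y`, where `0 < q < ∞` may depend on `Y`. Such a `Y` is in
bijection with `X`, so nothing is lost by taking it in the universe of `X`. -/
def IsQuasisymmetricallyThick {X : Type u} [MetricSpace X] (E : Set X) : Prop :=
  ∀ (Y : Type u) [MetricSpace Y] [MeasurableSpace Y] [BorelSpace Y] (q : ℝ) (f : X ≃ₜ Y),
    0 < q → IsAhlforsRegular Y q → IsQuasisymmetric f →
      0 < Measure.hausdorffMeasure q (f '' E)

/-- `E` is quasisymmetrically null: `H^q (f E) = 0` for every quasisymmetric homeomorphism `f`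
of `X` onto an Ahlfors `q`-regular space `Y`, where `0 < q < ∞` may depend on `Y`. -/
def IsQuasisymmetricallyNull {X : Type u} [MetricSpace X] (E : Set X) : Prop :=
  ∀ (Y : Type u) [MetricSpace Y] [MeasurableSpace Y] [BorelSpace Y] (q : ℝ) (f : X ≃ₜ Y),
    0 < q → IsAhlforsRegular Y q → IsQuasisymmetric f →
      Measure.hausdorffMeasure q (f '' E) = 0

/-!
The two classes of test objects, doubling measures on `X` and quasisymmetric images of `X` that are
Ahlfors regular, produce the same null sets in `X`; both equivalences follow.

* On an Ahlfors `q`-regular space the regular measure `ν` and the Hausdorff measure of dimension `q`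
  have the same null sets (`IsAhlforsMeasure.hausdorffMeasure_eq_zero_iff`): one direction is the
  mass distribution principle, the other is a Vitali covering of a small open neighbourhood.
* If `f : X → Y` is quasisymmetric and `ν` is regular on `Y`, then `A ↦ ν (f '' A)` is doubling on
  `X` (`IsAhlforsMeasure.isDoublingMeasure_map_symm`). Uniform perfectness provides, for each ball,
  a point whose distance to the centre is comparable to the radius, and quasisymmetry then squeezes
  the image of the ball between two comparable balls.
* Conversely, let `μ` be doubling on `X`. For small `ε > 0`, `μ (B(x, d(x, y))) ^ ε` is comparable
  to a metric (`IsDoublingWith.exists_metricSpace`). By doubling, and by reverse doubling, which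
  follows from uniform perfectness, the measure of a ball is controlled from both sides by powers of
  its radius (`IsDoublingWith.exists_growth_decay`). Hence the new metric has the same topology, the
  identity map to it is quasisymmetric, and `μ` is `1 / ε`-regular for it
  (`IsDoublingMeasure.exists_isAhlforsMeasure`).

The hypothesis allows the empty space, which is treated separately.
-/

/-! ### Ahlfors regular measures and Hausdorff measure -/

/-- `ν` is an Ahlfors `q`-regular measure on `Y` with constant `C`: the `ν`-measure of each closed
ball whose radius is positive and at most `diam Y` is comparable to the `q`-th power of the
radius. -/
def IsAhlforsMeasure {Y : Type u} [MetricSpace Y] [MeasurableSpace Y] (ν : Measure Y)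
    (q C : ℝ) : Prop :=
  ∀ (y : Y) (r : ℝ), 0 < r → ENNReal.ofReal r ≤ Metric.ediam (Set.univ : Set Y) →
    ENNReal.ofReal (C⁻¹ * r ^ q) ≤ ν (Metric.closedBall y r) ∧
      ν (Metric.closedBall y r) ≤ ENNReal.ofReal (C * r ^ q)

namespace IsAhlforsMeasure

variable {Y : Type u} [MetricSpace Y] [MeasurableSpace Y] {ν : Measure Y} {q C : ℝ}

/-- The upper bound holds without any restriction on the radius, because a ball of radius larger
than `diam Y` is the ball of radius `diam Y`. -/
theorem measure_closedBall_le [Nontrivial Y] (h : IsAhlforsMeasure ν q C) (hq : 0 < q)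
    (hC : 1 ≤ C) (y : Y) {r : ℝ} (hr : 0 < r) :
    ν (Metric.closedBall y r) ≤ ENNReal.ofReal (C * r ^ q) := by
  by_cases hd : ENNReal.ofReal r ≤ Metric.ediam (Set.univ : Set Y)
  · exact (h y r hr hd).2
  · rw [not_le] at hd
    have htop : Metric.ediam (Set.univ : Set Y) ≠ ∞ := (hd.trans ENNReal.ofReal_lt_top).ne
    have hpos : 0 < Metric.ediam (Set.univ : Set Y) :=
      Metric.ediam_pos_iff.2 Set.nontrivial_univ
    have hD : 0 < (Metric.ediam (Set.univ : Set Y)).toReal := ENNReal.toReal_pos hpos.ne' htop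
    have hDr : (Metric.ediam (Set.univ : Set Y)).toReal ≤ r :=
      ENNReal.toReal_le_of_le_ofReal hr.le hd.le
    calc ν (Metric.closedBall y r)
        ≤ ν (Metric.closedBall y (Metric.ediam (Set.univ : Set Y)).toReal) := by
          refine measure_mono fun z _ => ?_
          rw [Metric.mem_closedBall, dist_edist]
          exact ENNReal.toReal_mono htop
            (Metric.edist_le_ediam_of_mem (Set.mem_univ _) (Set.mem_univ _))
      _ ≤ ENNReal.ofReal (C * (Metric.ediam (Set.univ : Set Y)).toReal ^ q) :=
          (h y _ hD (ENNReal.ofReal_toReal htop).le).2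
      _ ≤ ENNReal.ofReal (C * r ^ q) := by gcongr

theorem measure_closedBall_pos [Nontrivial Y] (h : IsAhlforsMeasure ν q C)
    (hC : 1 ≤ C) (y : Y) {r : ℝ} (hr : 0 < r) : 0 < ν (Metric.closedBall y r) := by
  obtain ⟨a, b, hab⟩ := exists_pair_ne Y
  have hr' : 0 < min r (dist a b) := lt_min hr (dist_pos.2 hab)
  have h1 : ENNReal.ofReal (min r (dist a b)) ≤ Metric.ediam (Set.univ : Set Y) := by
    refine (ENNReal.ofReal_le_ofReal (min_le_right _ _)).trans ?_
    rw [← edist_dist]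
    exact Metric.edist_le_ediam_of_mem (Set.mem_univ _) (Set.mem_univ _)
  refine lt_of_lt_of_le ?_ ((h y _ hr' h1).1.trans
    (measure_mono (Metric.closedBall_subset_closedBall (min_le_left _ _))))
  rw [ENNReal.ofReal_pos]
  positivity

theorem sigmaFinite [Nontrivial Y] (h : IsAhlforsMeasure ν q C) (hq : 0 < q) (hC : 1 ≤ C) :
    SigmaFinite ν := by
  obtain ⟨y⟩ := (inferInstance : Nonempty Y)
  refine ⟨⟨⟨fun n : ℕ => Metric.closedBall y (n + 1), fun _ => trivial, fun n =>
    (h.measure_closedBall_le hq hC y (by positivity)).trans_lt ENNReal.ofReal_lt_top, ?_⟩⟩⟩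
  refine Set.eq_univ_of_forall fun z => Set.mem_iUnion.2 ?_
  obtain ⟨n, hn⟩ := exists_nat_ge (dist z y)
  exact ⟨n, by rw [Metric.mem_closedBall]; linarith⟩

theorem isLocallyFiniteMeasure [Nontrivial Y] (h : IsAhlforsMeasure ν q C) (hq : 0 < q)
    (hC : 1 ≤ C) : IsLocallyFiniteMeasure ν :=
  ⟨fun y => ⟨Metric.closedBall y 1, Metric.closedBall_mem_nhds y one_pos,
    (h.measure_closedBall_le hq hC y one_pos).trans_lt ENNReal.ofReal_lt_top⟩⟩

theorem countable_of_pairwiseDisjoint [BorelSpace Y] [Nontrivial Y] (h : IsAhlforsMeasure ν q C)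
    (hq : 0 < q) (hC : 1 ≤ C) {u : Set Y} {r : Y → ℝ} (hr : ∀ y ∈ u, 0 < r y)
    (hu : u.PairwiseDisjoint fun y => Metric.closedBall y (r y)) : u.Countable := by
  have := h.sigmaFinite hq hC
  have key := Measure.countable_meas_pos_of_disjoint_iUnion (μ := ν)
    (As := fun y : u => Metric.closedBall (y : Y) (r y))
    (fun _ => Metric.isClosed_closedBall.measurableSet)
    (fun a b hab => hu a.2 b.2 (fun e => hab (Subtype.ext e)))
  rw [← Set.countable_coe_iff, ← Set.countable_univ_iff]
  refine key.mono fun y _ => ?_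
  exact h.measure_closedBall_pos hC _ (hr y y.2)

theorem secondCountableTopology [BorelSpace Y] [Nontrivial Y] (h : IsAhlforsMeasure ν q C)
    (hq : 0 < q) (hC : 1 ≤ C) : SecondCountableTopology Y := by
  refine Metric.secondCountable_of_almost_dense_set fun ε hε => ?_
  obtain ⟨u, -, hdisj, hcov⟩ := Vitali.exists_disjoint_subfamily_covering_enlargement_closedBall
    (Set.univ : Set Y) id (fun _ => ε / 5) (ε / 5) (fun _ _ => le_rfl) 5 (by norm_num)
  refine ⟨u, h.countable_of_pairwiseDisjoint hq hC (fun _ _ => by positivity) hdisj, fun x => ?_⟩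
  obtain ⟨y, hy, hxy⟩ := hcov x trivial
  refine ⟨y, hy, ?_⟩
  have := hxy (Metric.mem_closedBall_self (by positivity))
  simpa [mul_div_cancel₀] using this

/-- A `ν`-null set has coverings with arbitrarily small `q`-dimensional content: the balls centred
at the set inside a small open neighbourhood have a disjoint subfamily whose five-fold enlargements
cover the set. -/
theorem exists_cover_of_null [BorelSpace Y] [Nontrivial Y] (h : IsAhlforsMeasure ν q C)
    (hq : 0 < q) (hC : 1 ≤ C) {A : Set Y} (hA : ν A = 0) {δ : ℝ} (hδ : 0 < δ) :
    ∃ (u : Set Y) (r : Y → ℝ), u.Countable ∧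
      (∀ y : u, Metric.ediam (Metric.closedBall (y : Y) (r y)) ≤ ENNReal.ofReal (2 * δ)) ∧
      A ⊆ ⋃ y : u, Metric.closedBall (y : Y) (r y) ∧
      ∑' y : u, Metric.ediam (Metric.closedBall (y : Y) (r y)) ^ q ≤
        ENNReal.ofReal (10 ^ q * C) * ENNReal.ofReal δ := by
  have := h.secondCountableTopology hq hC
  have := h.isLocallyFiniteMeasure hq hC
  obtain ⟨U, hAU, hU, hUδ⟩ := Set.exists_isOpen_lt_of_lt A (ENNReal.ofReal δ)
    (by rw [hA]; exact ENNReal.ofReal_pos.2 hδ)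
  obtain ⟨a, b, hab⟩ := exists_pair_ne Y
  have hball : ∀ y ∈ A, ∃ r : ℝ, 0 < r ∧ r ≤ δ / 5 ∧ r ≤ dist a b ∧
      Metric.closedBall y r ⊆ U := by
    intro y hy
    obtain ⟨s, hs, hsU⟩ := Metric.nhds_basis_closedBall.mem_iff.1 (hU.mem_nhds (hAU hy))
    refine ⟨min s (min (δ / 5) (dist a b)), lt_min hs (lt_min (by positivity) (dist_pos.2 hab)),
      (min_le_right _ _).trans (min_le_left _ _), (min_le_right _ _).trans (min_le_right _ _),
      (Metric.closedBall_subset_closedBall (min_le_left _ _)).trans hsU⟩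
  choose! r hr0 hrδ hrab hrU using hball
  obtain ⟨u, huA, hdisj, hcov⟩ := Vitali.exists_disjoint_subfamily_covering_enlargement_closedBall
    A id r (δ / 5) hrδ 5 (by norm_num)
  have hcount : u.Countable :=
    h.countable_of_pairwiseDisjoint hq hC (fun y hy => hr0 y (huA hy)) hdisj
  have hdiam : ∀ y : u, Metric.ediam (Metric.closedBall (y : Y) (5 * r y)) ≤
      ENNReal.ofReal (10 * r y) := by
    intro y
    have h0 := hr0 y (huA y.2)
    refine Metric.ediam_le fun z hz w hw => ?_
    rw [edist_dist]
    refine ENNReal.ofReal_le_ofReal ?_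
    have := dist_triangle_right z w y
    rw [Metric.mem_closedBall] at hz hw
    linarith
  refine ⟨u, fun y => 5 * r y, hcount, fun y => ?_, fun y hy => ?_, ?_⟩
  · refine (hdiam y).trans (ENNReal.ofReal_le_ofReal ?_)
    linarith [hrδ y (huA y.2)]
  · obtain ⟨z, hz, hyz⟩ := hcov y hy
    exact Set.mem_iUnion.2 ⟨⟨z, hz⟩, hyz (Metric.mem_closedBall_self (hr0 y hy).le)⟩
  · have hcu : Countable u := hcount
    calc ∑' y : u, Metric.ediam (Metric.closedBall (y : Y) (5 * r y)) ^ q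
        ≤ ∑' y : u, ENNReal.ofReal (10 ^ q * C) * ν (Metric.closedBall (y : Y) (r y)) := by
          refine ENNReal.tsum_le_tsum fun y => ?_
          have h0 := hr0 y (huA y.2)
          have hlow := (h y (r y) h0 (by
            refine (ENNReal.ofReal_le_ofReal (hrab y (huA y.2))).trans ?_
            rw [← edist_dist]
            exact Metric.edist_le_ediam_of_mem (Set.mem_univ _) (Set.mem_univ _))).1
          calc Metric.ediam (Metric.closedBall (y : Y) (5 * r y)) ^ q
              ≤ ENNReal.ofReal (10 * r y) ^ q := by gcongr; exact hdiam y
            _ = ENNReal.ofReal (10 ^ q * C) * ENNReal.ofReal (C⁻¹ * r y ^ q) := by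
                rw [ENNReal.ofReal_rpow_of_pos (by positivity),
                  ← ENNReal.ofReal_mul (by positivity),
                  Real.mul_rpow (by norm_num) h0.le]
                congr 1
                field_simp
            _ ≤ _ := by gcongr
      _ = ENNReal.ofReal (10 ^ q * C) * ν (⋃ y : u, Metric.closedBall (y : Y) (r y)) := by
          have hpair : Pairwise (Function.onFun Disjoint
              fun y : u => Metric.closedBall (y : Y) (r y)) :=
            fun a b hab => hdisj a.2 b.2 (fun e => hab (Subtype.ext e))
          rw [ENNReal.tsum_mul_left, measure_iUnion hpair
            (fun _ => Metric.isClosed_closedBall.measurableSet)]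
      _ ≤ ENNReal.ofReal (10 ^ q * C) * ENNReal.ofReal δ := by
          gcongr
          exact (measure_mono (Set.iUnion_subset fun y : u => hrU y (huA y.2))).trans hUδ.le

theorem hausdorffMeasure_eq_zero_of_null [BorelSpace Y] [Nontrivial Y]
    (h : IsAhlforsMeasure ν q C) (hq : 0 < q) (hC : 1 ≤ C) {A : Set Y} (hA : ν A = 0) :
    Measure.hausdorffMeasure q A = 0 := by
  have hlim : Filter.Tendsto (fun n : ℕ => (1 : ℝ) / (n + 1)) Filter.atTop (nhds 0) :=
    tendsto_one_div_add_atTop_nhds_zero_nat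
  choose u r hu hdiam hcov hsum using fun n : ℕ =>
    h.exists_cover_of_null hq hC hA (Nat.one_div_pos_of_nat (α := ℝ) (n := n))
  have : ∀ n, Countable (u n) := fun n => hu n
  have key := Measure.hausdorffMeasure_le_liminf_tsum (l := Filter.atTop) q A
    (fun n : ℕ => ENNReal.ofReal (2 * (1 / (n + 1))))
    (by simpa using ENNReal.tendsto_ofReal (hlim.const_mul 2))
    (fun n (y : u n) => Metric.closedBall (y : Y) (r n y))
    (Filter.Eventually.of_forall hdiam) (Filter.Eventually.of_forall hcov)
  refine le_antisymm (key.trans ?_) (zero_le)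
  have hlim' : Filter.Tendsto
      (fun n : ℕ => ENNReal.ofReal (10 ^ q * C) * ENNReal.ofReal (1 / (n + 1)))
      Filter.atTop (nhds 0) := by
    simpa using ENNReal.Tendsto.const_mul (a := ENNReal.ofReal (10 ^ q * C))
      (ENNReal.tendsto_ofReal hlim) (Or.inr ENNReal.ofReal_ne_top)
  rw [← hlim'.liminf_eq]
  exact Filter.liminf_le_liminf (Filter.Eventually.of_forall hsum)

/-- The mass distribution principle: a set of diameter `t` lies in a ball of radius `t`, so its
`ν`-measure is at most `C * t ^ q`. -/
theorem le_hausdorffMeasure [BorelSpace Y] [Nontrivial Y] (h : IsAhlforsMeasure ν q C)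
    (hq : 0 < q) (hC : 1 ≤ C) :
    (ENNReal.ofReal C)⁻¹ • ν ≤ Measure.hausdorffMeasure q := by
  refine Measure.le_hausdorffMeasure q _ 1 one_pos fun s hs => ?_
  rcases s.eq_empty_or_nonempty with rfl | ⟨y, hy⟩
  · simp
  have htop : Metric.ediam s ≠ ∞ := (hs.trans_lt ENNReal.one_lt_top).ne
  have hbound : ∀ t : ℝ, 0 < t →
      ν s ≤ ENNReal.ofReal (C * ((Metric.ediam s).toReal + t) ^ q) := by
    intro t ht
    have h0 : 0 ≤ (Metric.ediam s).toReal := ENNReal.toReal_nonneg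
    refine (measure_mono fun z hz => ?_).trans
      (h.measure_closedBall_le hq hC y (r := (Metric.ediam s).toReal + t) (by linarith))
    have h1 := ENNReal.toReal_mono htop (Metric.edist_le_ediam_of_mem hz hy)
    rw [← dist_edist] at h1
    rw [Metric.mem_closedBall]
    linarith
  have hcont : Filter.Tendsto
      (fun t : ℝ => ENNReal.ofReal (C * ((Metric.ediam s).toReal + t) ^ q))
      (nhdsWithin 0 (Set.Ioi 0)) (nhds (ENNReal.ofReal (C * (Metric.ediam s).toReal ^ q))) := by
    have hc : Continuous fun t : ℝ => ENNReal.ofReal (C * ((Metric.ediam s).toReal + t) ^ q) :=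
      ENNReal.continuous_ofReal.comp (continuous_const.mul
        ((continuous_const.add continuous_id).rpow_const fun _ => Or.inr hq.le))
    have := (hc.tendsto 0).mono_left (nhdsWithin_le_nhds (s := Set.Ioi (0 : ℝ)))
    simpa using this
  have hle := ge_of_tendsto hcont (Filter.eventually_of_mem self_mem_nhdsWithin hbound)
  rw [Measure.smul_apply, smul_eq_mul]
  calc (ENNReal.ofReal C)⁻¹ * ν s
      ≤ (ENNReal.ofReal C)⁻¹ * ENNReal.ofReal (C * (Metric.ediam s).toReal ^ q) := by gcongr
    _ = Metric.ediam s ^ q := by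
        rw [ENNReal.ofReal_mul (by linarith), ← mul_assoc, ENNReal.inv_mul_cancel
          (ENNReal.ofReal_pos.2 (by linarith)).ne' ENNReal.ofReal_ne_top, one_mul,
          ← ENNReal.ofReal_rpow_of_nonneg ENNReal.toReal_nonneg hq.le, ENNReal.ofReal_toReal htop]

theorem hausdorffMeasure_eq_zero_iff [BorelSpace Y] [Nontrivial Y] (h : IsAhlforsMeasure ν q C)
    (hq : 0 < q) (hC : 1 ≤ C) (A : Set Y) : Measure.hausdorffMeasure q A = 0 ↔ ν A = 0 := by
  refine ⟨fun hA => ?_, h.hausdorffMeasure_eq_zero_of_null hq hC⟩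
  have := h.le_hausdorffMeasure hq hC A
  rw [hA, nonpos_iff_eq_zero, Measure.smul_apply, smul_eq_mul, mul_eq_zero] at this
  exact this.resolve_left (ENNReal.inv_ne_zero.2 ENNReal.ofReal_ne_top)

end IsAhlforsMeasure

/-! ### Quasisymmetric homeomorphisms and doubling measures -/

/-- A self-homeomorphism of `[0, ∞)` is increasing. -/
theorem NNReal.strictMono_homeomorph (η : ℝ≥0 ≃ₜ ℝ≥0) : StrictMono η := by
  refine (η.continuous.strictMono_of_inj η.injective).resolve_right fun h => ?_
  obtain ⟨t, ht⟩ := η.surjective (η 0 + 1)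
  have : η t ≤ η 0 := h.antitone (zero_le)
  rw [ht] at this
  exact absurd this (not_le.2 (lt_add_of_pos_right _ one_pos))

section

variable {X Y : Type u} [MetricSpace X] [MetricSpace Y]

/-- The bound for quasisymmetric maps that remains true for triples that are not distinct. -/
theorem IsQuasisymmetric.exists_dist_le {f : X ≃ₜ Y} (hf : IsQuasisymmetric f) (T : ℝ) :
    ∃ H : ℝ, 1 ≤ H ∧ ∀ x y z : X, x ≠ z → dist x y ≤ T * dist x z →
      dist (f x) (f y) ≤ H * dist (f x) (f z) := by
  obtain ⟨η, hη⟩ := hf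
  refine ⟨max 1 (η T.toNNReal), le_max_left _ _, fun x y z hxz hT => ?_⟩
  have hfz : 0 < dist (f x) (f z) := dist_pos.2 (f.injective.ne hxz)
  rcases eq_or_ne x y with rfl | hxy
  · rw [dist_self]; positivity
  rcases eq_or_ne y z with rfl | hyz
  · exact le_mul_of_one_le_left hfz.le (le_max_left _ _)
  have h1 := hη x y z hxy hyz hxz
  have h2 : η (nndist x y / nndist x z) ≤ η T.toNNReal := by
    refine (NNReal.strictMono_homeomorph η).monotone ?_
    rw [← NNReal.coe_le_coe, NNReal.coe_div, coe_nndist, coe_nndist]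
    exact ((div_le_iff₀ (dist_pos.2 hxz)).2 hT).trans (Real.le_coe_toNNReal T)
  have h3 := NNReal.coe_le_coe.2 (h1.trans h2)
  rw [NNReal.coe_div, coe_nndist, coe_nndist, div_le_iff₀ hfz] at h3
  exact h3.trans (mul_le_mul_of_nonneg_right (le_max_right _ _) hfz.le)

variable [MeasurableSpace X] [BorelSpace X] [MeasurableSpace Y] [BorelSpace Y]

theorem Homeomorph.map_symm_apply (f : X ≃ₜ Y) (ν : Measure Y) (A : Set X) :
    ν.map f.symm A = ν (f '' A) := by
  rw [f.image_eq_preimage_symm]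
  exact f.symm.toMeasurableEquiv.map_apply A

/-- Quasisymmetric homeomorphisms of uniformly perfect spaces pull back regular measures to
doubling measures: if `z` lies in the annulus between `B(x, r / D)` and `B(x, r)`, then both
`f B(x, r)` and `f B(x, 2 r)` are comparable to the ball of radius `d(f x, f z)` at `f x`. -/
theorem IsAhlforsMeasure.isDoublingMeasure_map_symm [Nontrivial X]
    (hX : IsUniformlyPerfect X) {f : X ≃ₜ Y} (hf : IsQuasisymmetric f) {ν : Measure Y} {q C : ℝ}
    (h : IsAhlforsMeasure ν q C) (hq : 0 < q) (hC : 1 ≤ C) :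
    IsDoublingMeasure (ν.map f.symm) := by
  have : Nontrivial Y := f.injective.nontrivial
  obtain ⟨-, D, hD, hperf⟩ := hX
  obtain ⟨H₁, hH₁, hf₁⟩ := hf.exists_dist_le (2 * D)
  obtain ⟨H₂, hH₂, hf₂⟩ := hf.exists_dist_le 1
  set K : ℝ := C * C * (2 * H₁ * H₂) ^ q with hK
  have hK1 : 1 ≤ K :=
    one_le_mul_of_one_le_of_one_le (one_le_mul_of_one_le_of_one_le hC hC)
      (Real.one_le_rpow (by nlinarith) hq.le)
  have main : ∀ (x : X) (r : ℝ), 0 < r →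
      ν (f '' Metric.closedBall x (2 * r)) < ∞ ∧
      ν (f '' Metric.closedBall x (2 * r)) ≤ ENNReal.ofReal K * ν (f '' Metric.closedBall x r) ∧
      0 < ν (f '' Metric.closedBall x r) := by
    intro x r hr
    by_cases hne : (Set.univ \ Metric.closedBall x r).Nonempty
    · obtain ⟨z, hz1, hz2⟩ := hperf x r hr hne
      rw [Metric.mem_closedBall'] at hz1 hz2
      rw [not_le] at hz2
      have hxz : x ≠ z := by
        rintro rfl
        rw [dist_self] at hz2
        exact absurd hz2 (not_lt.2 (by positivity))
      have hs : 0 < dist (f x) (f z) := dist_pos.2 (f.injective.ne hxz)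
      have hrz : r < D * dist x z := by
        rwa [div_lt_iff₀ (by linarith), mul_comm] at hz2
      have hup : f '' Metric.closedBall x (2 * r) ⊆
          Metric.closedBall (f x) (H₁ * dist (f x) (f z)) := by
        rintro _ ⟨y, hy, rfl⟩
        rw [Metric.mem_closedBall'] at hy ⊢
        exact hf₁ x y z hxz (by nlinarith)
      have hlow : Metric.closedBall (f x) (dist (f x) (f z) / (2 * H₂)) ⊆
          f '' Metric.closedBall x r := by
        intro w hw
        obtain ⟨y, rfl⟩ := f.surjective w
        refine ⟨y, ?_, rfl⟩
        by_contra hy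
        rw [Metric.mem_closedBall', not_le] at hy
        rw [Metric.mem_closedBall', le_div_iff₀ (by positivity)] at hw
        have hxy : x ≠ y := dist_pos.1 (hr.trans hy)
        have := hf₂ x z y hxy (by linarith)
        nlinarith
      have h1 := (measure_mono hup).trans
        (h.measure_closedBall_le hq hC (f x) (r := H₁ * dist (f x) (f z)) (by positivity))
      have hle : dist (f x) (f z) / (2 * H₂) ≤ dist (f x) (f z) :=
        div_le_self hs.le (by linarith)
      have h2 := ((h (f x) (dist (f x) (f z) / (2 * H₂)) (by positivity) (by
        refine (ENNReal.ofReal_le_ofReal hle).trans ?_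
        rw [← edist_dist]
        exact Metric.edist_le_ediam_of_mem (Set.mem_univ _) (Set.mem_univ _))).1).trans
          (measure_mono hlow)
      have heq : C * (H₁ * dist (f x) (f z)) ^ q =
          K * (C⁻¹ * (dist (f x) (f z) / (2 * H₂)) ^ q) := by
        rw [hK, show H₁ * dist (f x) (f z) =
          (2 * H₁ * H₂) * (dist (f x) (f z) / (2 * H₂)) by field_simp,
          Real.mul_rpow (by positivity) (by positivity)]
        field_simp
      rw [heq] at h1
      refine ⟨h1.trans_lt ENNReal.ofReal_lt_top, ?_, ?_⟩
      · refine h1.trans ?_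
        rw [ENNReal.ofReal_mul (by linarith)]
        gcongr
      · refine lt_of_lt_of_le ?_ h2
        rw [ENNReal.ofReal_pos]
        positivity
    · -- Here `X` is bounded and equal to both balls, and `Y` is bounded as well.
      have hall : ∀ y, dist x y ≤ r := by
        intro y
        by_contra hy
        exact hne ⟨y, trivial, by rwa [Metric.mem_closedBall']⟩
      obtain ⟨z, hz⟩ := exists_ne x
      obtain ⟨H, hH, hfH⟩ := hf.exists_dist_le (r / dist x z)
      have hs : 0 < dist (f x) (f z) := dist_pos.2 (f.injective.ne hz.symm)
      have hsub : ∀ A : Set Y, A ⊆ Metric.closedBall (f x) (H * dist (f x) (f z)) := by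
        intro A w _
        obtain ⟨y, rfl⟩ := f.surjective w
        rw [Metric.mem_closedBall']
        refine hfH x y z hz.symm ?_
        rw [div_mul_cancel₀ _ (dist_pos.2 hz.symm).ne']
        exact hall y
      have hfin := fun A : Set Y => (measure_mono (μ := ν) (hsub A)).trans
        (h.measure_closedBall_le hq hC (f x) (r := H * dist (f x) (f z)) (by positivity))
      have huniv : f '' Metric.closedBall x r = Set.univ := by
        refine Set.eq_univ_of_forall fun w => ?_
        obtain ⟨y, rfl⟩ := f.surjective w
        exact ⟨y, by rw [Metric.mem_closedBall']; exact hall y, rfl⟩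
      refine ⟨(hfin _).trans_lt ENNReal.ofReal_lt_top, ?_, ?_⟩
      · rw [huniv]
        refine (measure_mono (Set.subset_univ _)).trans ?_
        refine le_mul_of_one_le_left (zero_le) ?_
        rwa [ENNReal.one_le_ofReal]
      · rw [huniv]
        exact (h.measure_closedBall_pos hC (f x) one_pos).trans_le
          (measure_mono (Set.subset_univ _))
  refine ⟨K.toNNReal, by rwa [Real.one_le_toNNReal], fun x r hr => ?_⟩
  simp only [Homeomorph.map_symm_apply]
  obtain ⟨-, hdbl, hpos⟩ := main x r hr
  obtain ⟨hfin, -, -⟩ := main x (r / 2) (half_pos hr)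
  rw [mul_div_cancel₀ _ two_ne_zero] at hfin
  refine ⟨hpos.trans_le (measure_mono (Set.image_mono
    (Metric.closedBall_subset_closedBall (by linarith)))), hdbl,
    ENNReal.mul_lt_top ENNReal.coe_lt_top hfin⟩

end

/-! ### Growth of doubling measures -/

/-- `μ` is doubling with constant `C`, expressed through the real-valued measure of balls; the
finiteness of all balls is recorded separately. -/
structure IsDoublingWith {X : Type u} [MetricSpace X] [MeasurableSpace X] (μ : Measure X)
    (C : ℝ) : Prop where
  one_le : 1 ≤ C
  ne_top : ∀ (x : X) (r : ℝ), μ (Metric.closedBall x r) ≠ ∞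
  pos : ∀ (x : X) {r : ℝ}, 0 < r → 0 < μ.real (Metric.closedBall x r)
  doubling : ∀ (x : X) {r : ℝ}, 0 < r →
    μ.real (Metric.closedBall x (2 * r)) ≤ C * μ.real (Metric.closedBall x r)

section

variable {X : Type u} [MetricSpace X] [MeasurableSpace X] {μ : Measure X} {C : ℝ}

theorem IsDoublingMeasure.exists_isDoublingWith [BorelSpace X] (h : IsDoublingMeasure μ) :
    ∃ C : ℝ, IsDoublingWith μ C := by
  obtain ⟨C, hC, h⟩ := h
  have hfin : ∀ (x : X) (r : ℝ), μ (Metric.closedBall x r) ≠ ∞ := by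
    intro x r
    obtain ⟨-, h2, h3⟩ := h x (max r 1) (by positivity)
    refine ((measure_mono (Metric.closedBall_subset_closedBall ?_)).trans_lt
      (h2.trans_lt h3)).ne
    linarith [le_max_left r 1, le_max_right r 1]
  refine ⟨C, by exact_mod_cast hC, hfin, fun x r hr => ?_, fun x r hr => ?_⟩
  · have := (h x (r / 2) (half_pos hr)).1
    rw [mul_div_cancel₀ _ two_ne_zero] at this
    exact ENNReal.toReal_pos this.ne' (hfin x r)
  · obtain ⟨-, h2, h3⟩ := h x r hr
    simpa [Measure.real] using ENNReal.toReal_mono h3.ne h2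

namespace IsDoublingWith

theorem real_mono (h : IsDoublingWith μ C) {A : Set X} {x : X} {r : ℝ}
    (hA : A ⊆ Metric.closedBall x r) : μ.real A ≤ μ.real (Metric.closedBall x r) :=
  measureReal_mono hA (h.ne_top x r)

theorem doubling_pow (h : IsDoublingWith μ C) (x : X) {r : ℝ} (hr : 0 ≤ r) (n : ℕ) :
    μ.real (Metric.closedBall x (2 ^ n * r)) ≤ C ^ n * μ.real (Metric.closedBall x r) := by
  rcases hr.eq_or_lt with rfl | hr
  · rw [mul_zero]
    exact le_mul_of_one_le_left measureReal_nonneg (one_le_pow₀ h.one_le)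
  induction n with
  | zero => simp
  | succ n ih =>
    have h1 := h.doubling x (r := 2 ^ n * r) (by positivity)
    have h2 := mul_le_mul_of_nonneg_left ih (zero_le_one.trans h.one_le)
    calc _ = μ.real (Metric.closedBall x (2 * (2 ^ n * r))) := by ring_nf
      _ ≤ _ := h1
      _ ≤ _ := h2
      _ = _ := by ring

theorem real_closedBall_le (h : IsDoublingWith μ C) {x y : X} {r s : ℝ} (hs : 0 ≤ s) {n : ℕ}
    (hxy : r + dist x y ≤ 2 ^ n * s) :
    μ.real (Metric.closedBall x r) ≤ C ^ n * μ.real (Metric.closedBall y s) :=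
  (h.real_mono (Metric.closedBall_subset_closedBall' hxy)).trans (h.doubling_pow y hs n)

theorem growth (h : IsDoublingWith μ C) (x : X) {r t a : ℝ} (hr : 0 ≤ r) (ht : 1 ≤ t)
    (ha : 0 < a) (hCa : C ≤ 2 ^ a) :
    μ.real (Metric.closedBall x (t * r)) ≤ 2 ^ a * t ^ a * μ.real (Metric.closedBall x r) := by
  have hC := h.one_le
  obtain ⟨n, hn1, hn2⟩ := exists_nat_pow_near ht one_lt_two
  calc μ.real (Metric.closedBall x (t * r))
      ≤ μ.real (Metric.closedBall x (2 ^ (n + 1) * r)) :=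
        h.real_mono (Metric.closedBall_subset_closedBall (by gcongr))
    _ ≤ C ^ (n + 1) * μ.real (Metric.closedBall x r) := h.doubling_pow x hr _
    _ ≤ (2 ^ a) ^ (n + 1) * μ.real (Metric.closedBall x r) := by gcongr
    _ = 2 ^ a * ((2 : ℝ) ^ n) ^ a * μ.real (Metric.closedBall x r) := by
        rw [pow_succ', ← Real.rpow_natCast (2 ^ a) n, ← Real.rpow_natCast 2 n,
          ← Real.rpow_mul (by norm_num), ← Real.rpow_mul (by norm_num), mul_comm a]
    _ ≤ 2 ^ a * t ^ a * μ.real (Metric.closedBall x r) := by gcongr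

/-- Reverse doubling: by uniform perfectness, `B(x, R)` contains a ball disjoint from `B(x, R / l)`
and of comparable measure. -/
theorem exists_reverse_doubling [BorelSpace X] (h : IsDoublingWith μ C)
    (hX : IsUniformlyPerfect X) :
    ∃ l θ : ℝ, 0 < l ∧ l < 1 ∧ 0 < θ ∧ θ < 1 ∧ ∀ (x z : X) (R : ℝ), 0 < R → R ≤ dist x z →
      μ.real (Metric.closedBall x (l * R)) ≤ θ * μ.real (Metric.closedBall x R) := by
  obtain ⟨-, D, hD, hperf⟩ := hX
  obtain ⟨k, hk⟩ := pow_unbounded_of_one_lt (8 * D) one_lt_two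
  have hC := h.one_le
  have hCk : 1 ≤ C ^ k := one_le_pow₀ hC
  have hCk' : (C ^ k)⁻¹ ≤ 1 := inv_le_one_of_one_le₀ hCk
  have hCk0 : 0 < (C ^ k)⁻¹ := by positivity
  -- The factor `1 / 2` only serves to keep `θ` positive when `C = 1`.
  refine ⟨(4 * D)⁻¹, 1 - (C ^ k)⁻¹ / 2, by positivity, inv_lt_one_of_one_lt₀ (by linarith),
    by linarith, by linarith, fun x z R hR hRz => ?_⟩
  obtain ⟨y, hy1, hy2⟩ := hperf x (R / 2) (half_pos hR)
    ⟨z, trivial, by rw [Metric.mem_closedBall', not_le]; linarith⟩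
  rw [Metric.mem_closedBall'] at hy1 hy2
  rw [not_le] at hy2
  set s := (4 * D)⁻¹ * R with hs
  have hs0 : 0 < s := by positivity
  have hs2 : R / 2 / D = 2 * s := by rw [hs]; field_simp; norm_num
  have hRs : R = 4 * D * s := by rw [hs]; field_simp
  have hsR : s ≤ R / 4 := by nlinarith
  rw [hs2] at hy2
  have hdisj : Disjoint (Metric.closedBall x s) (Metric.closedBall y s) :=
    Metric.closedBall_disjoint_closedBall (by linarith)
  have hsum : μ.real (Metric.closedBall x s) + μ.real (Metric.closedBall y s) ≤
      μ.real (Metric.closedBall x R) := by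
    rw [← measureReal_union hdisj Metric.isClosed_closedBall.measurableSet
      (h.ne_top x s) (h.ne_top y s)]
    refine h.real_mono (Set.union_subset (Metric.closedBall_subset_closedBall (by linarith))
      (Metric.closedBall_subset_closedBall' ?_))
    rw [dist_comm]
    linarith
  have hcmp := h.real_closedBall_le (x := x) (y := y) (r := R) hs0.le (n := k) (by nlinarith)
  have hcmp' : (C ^ k)⁻¹ * μ.real (Metric.closedBall x R) ≤ μ.real (Metric.closedBall y s) := by
    rwa [inv_mul_le_iff₀ (by positivity)]
  have : 0 ≤ (C ^ k)⁻¹ * μ.real (Metric.closedBall x R) :=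
    mul_nonneg hCk0.le measureReal_nonneg
  linarith

theorem exists_decay [BorelSpace X] (h : IsDoublingWith μ C) (hX : IsUniformlyPerfect X) :
    ∃ b K : ℝ, 0 < b ∧ 0 < K ∧ ∀ (x z : X) (R t : ℝ), 0 < R → R ≤ dist x z → 0 < t → t ≤ 1 →
      μ.real (Metric.closedBall x (t * R)) ≤ K * t ^ b * μ.real (Metric.closedBall x R) := by
  obtain ⟨l, θ, hl0, hl1, hθ0, hθ1, hrev⟩ := h.exists_reverse_doubling hX
  have hb : 0 < Real.log θ / Real.log l :=
    div_pos_of_neg_of_neg (Real.log_neg hθ0 hθ1) (Real.log_neg hl0 hl1)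
  have hlb : l ^ (Real.log θ / Real.log l) = θ := by
    rw [Real.rpow_def_of_pos hl0, mul_div_cancel₀ _ (Real.log_neg hl0 hl1).ne, Real.exp_log hθ0]
  set b := Real.log θ / Real.log l
  refine ⟨b, θ⁻¹, hb, by positivity, fun x z R t hR hRz ht0 ht1 => ?_⟩
  have hiter : ∀ n : ℕ, μ.real (Metric.closedBall x (l ^ n * R)) ≤
      θ ^ n * μ.real (Metric.closedBall x R) := by
    intro n
    induction n with
    | zero => simp
    | succ n ih =>
      have h1 := hrev x z (l ^ n * R) (by positivity)
        ((mul_le_of_le_one_left hR.le (pow_le_one₀ hl0.le hl1.le)).trans hRz)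
      calc _ = μ.real (Metric.closedBall x (l * (l ^ n * R))) := by ring_nf
        _ ≤ _ := h1
        _ ≤ θ * (θ ^ n * μ.real (Metric.closedBall x R)) := by gcongr
        _ = _ := by ring
  obtain ⟨n, hn1, hn2⟩ := exists_nat_pow_near_of_lt_one ht0 ht1 hl0 hl1
  calc μ.real (Metric.closedBall x (t * R))
      ≤ μ.real (Metric.closedBall x (l ^ n * R)) :=
        h.real_mono (Metric.closedBall_subset_closedBall (by gcongr))
    _ ≤ θ ^ n * μ.real (Metric.closedBall x R) := hiter n
    _ = θ⁻¹ * (l ^ (n + 1)) ^ b * μ.real (Metric.closedBall x R) := by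
        rw [← Real.rpow_natCast l, ← Real.rpow_mul hl0.le, mul_comm _ b, Real.rpow_mul hl0.le,
          hlb, Real.rpow_natCast, pow_succ']
        field_simp
    _ ≤ θ⁻¹ * t ^ b * μ.real (Metric.closedBall x R) := by gcongr

/-- The measure of a ball grows at most, and decays at least, like a power of the radius. -/
theorem exists_growth_decay [BorelSpace X] (h : IsDoublingWith μ C)
    (hX : IsUniformlyPerfect X) :
    ∃ a b K : ℝ, 0 < a ∧ 0 < b ∧ 0 < K ∧ ∀ (x z : X) (t : ℝ), x ≠ z → 0 < t →
      μ.real (Metric.closedBall x (t * dist x z)) ≤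
        K * (t ^ a + t ^ b) * μ.real (Metric.closedBall x (dist x z)) := by
  obtain ⟨b, K, hb, hK, hdec⟩ := h.exists_decay hX
  have hC := h.one_le
  have ha : 0 < Real.logb 2 (2 * C) := Real.logb_pos one_lt_two (by linarith)
  have hCa : C ≤ 2 ^ Real.logb 2 (2 * C) := by
    rw [Real.rpow_logb two_pos (by norm_num) (by positivity)]
    linarith
  set a := Real.logb 2 (2 * C)
  refine ⟨a, b, 2 ^ a + K, ha, hb, by positivity, fun x z t hxz ht => ?_⟩
  have hm := (h.pos x (dist_pos.2 hxz)).le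
  have hta : 0 < t ^ a := by positivity
  have htb : 0 < t ^ b := by positivity
  have h2a : (0 : ℝ) < 2 ^ a := by positivity
  rcases le_total 1 t with h1 | h1
  · refine (h.growth x dist_nonneg h1 ha hCa).trans (mul_le_mul_of_nonneg_right ?_ hm)
    nlinarith [mul_pos h2a htb, mul_pos hK hta, mul_pos hK htb]
  · refine (hdec x z _ t (dist_pos.2 hxz) le_rfl ht h1).trans
      (mul_le_mul_of_nonneg_right ?_ hm)
    nlinarith [mul_pos h2a htb, mul_pos h2a hta, mul_pos hK hta]

theorem tendsto_real_closedBall [BorelSpace X] [Nontrivial X] (h : IsDoublingWith μ C)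
    (hX : IsUniformlyPerfect X) (x : X) :
    Filter.Tendsto (fun r : ℝ => μ.real (Metric.closedBall x r)) (nhdsWithin 0 (Set.Ioi 0))
      (nhds 0) := by
  obtain ⟨a, b, K, ha, hb, hK, hle⟩ := h.exists_growth_decay hX
  obtain ⟨z, hz⟩ := exists_ne x
  have hd := dist_pos.2 hz.symm
  set M := μ.real (Metric.closedBall x (dist x z))
  have hc : Continuous fun r : ℝ => K * ((r / dist x z) ^ a + (r / dist x z) ^ b) * M := by
    have hdiv : Continuous fun r : ℝ => r / dist x z := continuous_id.div_const _
    exact (continuous_const.mul ((hdiv.rpow_const fun _ => Or.inr ha.le).add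
      (hdiv.rpow_const fun _ => Or.inr hb.le))).mul continuous_const
  have hlim := (hc.tendsto 0).mono_left (nhdsWithin_le_nhds (s := Set.Ioi (0 : ℝ)))
  simp only [zero_div, Real.zero_rpow ha.ne', Real.zero_rpow hb.ne', add_zero, mul_zero,
    zero_mul] at hlim
  refine tendsto_of_tendsto_of_tendsto_of_le_of_le' tendsto_const_nhds hlim
    (Filter.Eventually.of_forall fun r => measureReal_nonneg)
    (Filter.eventually_of_mem self_mem_nhdsWithin fun r hr => ?_)
  have := hle x z (r / dist x z) hz.symm (div_pos hr hd)
  rwa [div_mul_cancel₀ _ hd.ne'] at this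

theorem real_closedBall_zero [BorelSpace X] [Nontrivial X] (h : IsDoublingWith μ C)
    (hX : IsUniformlyPerfect X) (x : X) : μ.real (Metric.closedBall x 0) = 0 := by
  refine le_antisymm (ge_of_tendsto (h.tendsto_real_closedBall hX x)
    (Filter.eventually_of_mem self_mem_nhdsWithin fun r hr => ?_)) measureReal_nonneg
  exact h.real_mono (Metric.closedBall_subset_closedBall (le_of_lt hr))

/-! ### The metric associated with a doubling measure -/

/-- A power of the quasimetric `max (μ B(x, d(x, y))) (μ B(y, d(x, y)))` satisfies the hypothesis
of the chain construction `PseudoMetricSpace.ofPreNNDist`, so it is comparable to a metric. The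
latter is put on a second space, in bijection with `X`, because it need not agree with the metric
of `X`. -/
theorem exists_metricSpace (h : IsDoublingWith μ C)
    (h0 : ∀ x, μ.real (Metric.closedBall x 0) = 0) :
    ∃ (Y : Type u) (_ : MetricSpace Y) (e : X ≃ Y) (ε A : ℝ), 0 < ε ∧ 1 ≤ A ∧ ∀ x y : X,
      μ.real (Metric.closedBall x (dist x y)) ^ ε ≤ A * dist (e x) (e y) ∧
        dist (e x) (e y) ≤ A * μ.real (Metric.closedBall x (dist x y)) ^ ε := by
  have hC := h.one_le
  have hC3 : 1 ≤ C ^ 3 := one_le_pow₀ hC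
  have hε : 0 < Real.logb (C ^ 3 + 1) 2 := Real.logb_pos (by linarith) one_lt_two
  have hKε : (C ^ 3) ^ Real.logb (C ^ 3 + 1) 2 ≤ 2 :=
    calc (C ^ 3) ^ Real.logb (C ^ 3 + 1) 2
        ≤ (C ^ 3 + 1) ^ Real.logb (C ^ 3 + 1) 2 := by gcongr; linarith
      _ = 2 := Real.rpow_logb (by linarith) (by linarith) two_pos
  set ε := Real.logb (C ^ 3 + 1) 2
  set ρ : X → X → ℝ := fun x y => max (μ.real (Metric.closedBall x (dist x y)))
    (μ.real (Metric.closedBall y (dist x y))) with hρ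
  have hρ0 : ∀ x y, 0 ≤ ρ x y := fun x y => le_max_of_le_left measureReal_nonneg
  have hleft : ∀ x y, μ.real (Metric.closedBall x (dist x y)) ≤ ρ x y :=
    fun x y => le_max_left _ _
  have hright : ∀ x y, ρ x y ≤ C * μ.real (Metric.closedBall x (dist x y)) := by
    intro x y
    refine max_le (le_mul_of_one_le_left measureReal_nonneg hC) ?_
    have := h.real_closedBall_le (x := y) (y := x) (r := dist x y) (s := dist x y)
      dist_nonneg (n := 1) (by rw [dist_comm y x]; linarith)
    rwa [pow_one] at this
  -- If `d` is the largest of the three consecutive distances and `p` the left one of the two points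
  -- that realize it, then the balls of radius `d(x₁, x₄)` at `x₁` and `x₄` lie in `B(p, 8 d)`.
  have hquad : ∀ x₁ x₂ x₃ x₄,
      ρ x₁ x₄ ≤ C ^ 3 * max (ρ x₁ x₂) (max (ρ x₂ x₃) (ρ x₃ x₄)) := by
    intro x₁ x₂ x₃ x₄
    have t1 := dist_triangle4 x₁ x₂ x₃ x₄
    have t2 := dist_triangle x₁ x₂ x₃
    have t3 := dist_triangle x₂ x₃ x₄
    have key : ∀ p q, dist x₁ x₄ + dist x₁ p ≤ 8 * dist p q →
        dist x₁ x₄ + dist x₄ p ≤ 8 * dist p q → ρ x₁ x₄ ≤ C ^ 3 * ρ p q := by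
      intro p q h1 h2
      refine (max_le ?_ ?_ : ρ x₁ x₄ ≤ C ^ 3 * μ.real (Metric.closedBall p (dist p q))).trans
        (by gcongr; exact hleft p q)
      · exact h.real_closedBall_le dist_nonneg (by linarith)
      · exact h.real_closedBall_le dist_nonneg (by linarith)
    have n1 := dist_nonneg (x := x₁) (y := x₂)
    have n2 := dist_nonneg (x := x₂) (y := x₃)
    have n3 := dist_nonneg (x := x₃) (y := x₄)
    by_cases c1 : dist x₂ x₃ ≤ dist x₁ x₂ ∧ dist x₃ x₄ ≤ dist x₁ x₂
    · refine (key x₁ x₂ ?_ ?_).trans (by gcongr; exact le_max_left _ _)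
      · rw [dist_self]; linarith
      · rw [dist_comm x₄ x₁]; linarith
    by_cases c2 : dist x₃ x₄ ≤ dist x₂ x₃ ∧ dist x₁ x₂ ≤ dist x₂ x₃
    · refine (key x₂ x₃ ?_ ?_).trans
        (by gcongr; exact (le_max_left _ _).trans (le_max_right _ _))
      · linarith
      · rw [dist_comm x₄ x₂]; linarith
    · have c3 : dist x₁ x₂ ≤ dist x₃ x₄ ∧ dist x₂ x₃ ≤ dist x₃ x₄ := by
        by_contra c3
        rcases le_total (dist x₁ x₂) (dist x₂ x₃) with u | u <;>
        rcases le_total (dist x₂ x₃) (dist x₃ x₄) with v | v <;>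
        rcases le_total (dist x₁ x₂) (dist x₃ x₄) with w | w <;>
        first
          | exact c1 ⟨by linarith, by linarith⟩
          | exact c2 ⟨by linarith, by linarith⟩
          | exact c3 ⟨by linarith, by linarith⟩
      refine (key x₃ x₄ ?_ ?_).trans
        (by gcongr; exact (le_max_right _ _).trans (le_max_right _ _))
      · linarith
      · rw [dist_comm x₄ x₃]; linarith
  set δ : X → X → ℝ≥0 := fun x y => ⟨ρ x y ^ ε, Real.rpow_nonneg (hρ0 x y) ε⟩
  have hδcoe : ∀ x y, (δ x y : ℝ) = ρ x y ^ ε := fun _ _ => rfl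
  have hself : ∀ x, δ x x = 0 := by
    intro x
    rw [← NNReal.coe_eq_zero, hδcoe]
    simp only [hρ, dist_self, h0, max_self]
    exact Real.zero_rpow hε.ne'
  have hcomm : ∀ x y, δ x y = δ y x := by
    intro x y
    rw [← NNReal.coe_inj, hδcoe, hδcoe]
    simp only [hρ, dist_comm x y, max_comm]
  have hδquad : ∀ x₁ x₂ x₃ x₄, δ x₁ x₄ ≤ 2 * max (δ x₁ x₂) (max (δ x₂ x₃) (δ x₃ x₄)) := by
    intro x₁ x₂ x₃ x₄
    rw [← NNReal.coe_le_coe]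
    push_cast
    simp only [hδcoe]
    have hmax : ∀ u v : ℝ, 0 ≤ u → 0 ≤ v → max u v ^ ε = max (u ^ ε) (v ^ ε) := by
      intro u v hu hv
      rcases le_total u v with huv | huv
      · rw [max_eq_right huv, max_eq_right (Real.rpow_le_rpow hu huv hε.le)]
      · rw [max_eq_left huv, max_eq_left (Real.rpow_le_rpow hv huv hε.le)]
    rw [← hmax _ _ (hρ0 _ _) (hρ0 _ _), ← hmax _ _ (hρ0 _ _) (le_max_of_le_left (hρ0 _ _))]
    have hm : 0 ≤ max (ρ x₁ x₂) (max (ρ x₂ x₃) (ρ x₃ x₄)) := le_max_of_le_left (hρ0 _ _)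
    calc ρ x₁ x₄ ^ ε ≤ (C ^ 3 * max (ρ x₁ x₂) (max (ρ x₂ x₃) (ρ x₃ x₄))) ^ ε :=
          Real.rpow_le_rpow (hρ0 _ _) (hquad _ _ _ _) hε.le
      _ = (C ^ 3) ^ ε * max (ρ x₁ x₂) (max (ρ x₂ x₃) (ρ x₃ x₄)) ^ ε :=
          Real.mul_rpow (by positivity) hm
      _ ≤ _ := by gcongr
  have hpow_le : ∀ x y, μ.real (Metric.closedBall x (dist x y)) ^ ε ≤ ρ x y ^ ε :=
    fun x y => Real.rpow_le_rpow measureReal_nonneg (hleft x y) hε.le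
  have hpow_ge : ∀ x y,
      ρ x y ^ ε ≤ C ^ ε * μ.real (Metric.closedBall x (dist x y)) ^ ε := by
    intro x y
    rw [← Real.mul_rpow (by positivity) measureReal_nonneg]
    exact Real.rpow_le_rpow (hρ0 x y) (hright x y) hε.le
  let P : PseudoMetricSpace X := PseudoMetricSpace.ofPreNNDist δ hself hcomm
  have hlow : ∀ x y, ρ x y ^ ε ≤ 2 * P.dist x y :=
    PseudoMetricSpace.le_two_mul_dist_ofPreNNDist δ hself hcomm hδquad
  have hup : ∀ x y, P.dist x y ≤ ρ x y ^ ε :=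
    PseudoMetricSpace.dist_ofPreNNDist_le δ hself hcomm
  have hPnonneg : ∀ x y, 0 ≤ P.dist x y := by
    intro x y
    have := (Real.rpow_nonneg (hρ0 x y) ε).trans (hlow x y)
    linarith
  have hsep : ∀ x y, P.dist x y = 0 → x = y := by
    intro x y hxy
    by_contra hne
    have h1 := hlow x y
    rw [hxy, mul_zero] at h1
    exact absurd h1 (not_le.2 (Real.rpow_pos_of_pos
      ((h.pos x (dist_pos.2 hne)).trans_le (hleft x y)) ε))
  refine ⟨X, { P with eq_of_dist_eq_zero := hsep _ _ }, Equiv.refl X, ε, max 2 (C ^ ε), hε,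
    le_max_of_le_left one_le_two, fun x y => ⟨?_, ?_⟩⟩
  · exact ((hpow_le x y).trans (hlow x y)).trans
      (mul_le_mul_of_nonneg_right (le_max_left _ _) (hPnonneg x y))
  · exact ((hup x y).trans (hpow_ge x y)).trans
      (mul_le_mul_of_nonneg_right (le_max_right _ _) (Real.rpow_nonneg measureReal_nonneg ε))

end IsDoublingWith

end

/-! ### Regularity and quasisymmetry of the associated metric -/

theorem NNReal.exists_homeomorph_eq {g : ℝ≥0 → ℝ≥0} (hmono : StrictMono g) (hcont : Continuous g)
    (h0 : g 0 = 0) (htop : Filter.Tendsto g Filter.atTop Filter.atTop) :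
    ∃ η : ℝ≥0 ≃ₜ ℝ≥0, ∀ t, η t = g t := by
  have hsurj : Function.Surjective g := fun c =>
    mem_range_of_exists_le_of_exists_ge hcont ⟨0, by rw [h0]; exact zero_le⟩
      (htop.eventually_ge_atTop c).exists
  exact ⟨(hmono.orderIsoOfSurjective g hsurj).toHomeomorph, fun _ => rfl⟩

namespace IsDoublingWith

variable {X Y : Type u} [MetricSpace X] [MeasurableSpace X] [BorelSpace X] {μ : Measure X}
  {C ε A : ℝ}

/-- A metric comparable to `μ(B(x, d(x, y))) ^ ε` induces the given topology. -/
theorem exists_homeomorph [Nontrivial X] [MetricSpace Y] (h : IsDoublingWith μ C)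
    (hX : IsUniformlyPerfect X) (e : X ≃ Y) (hε : 0 < ε) (hA : 1 ≤ A)
    (hlow : ∀ x y : X,
      μ.real (Metric.closedBall x (dist x y)) ^ ε ≤ A * dist (e x) (e y))
    (hup : ∀ x y : X,
      dist (e x) (e y) ≤ A * μ.real (Metric.closedBall x (dist x y)) ^ ε) :
    ∃ f : X ≃ₜ Y, ∀ x, f x = e x := by
  refine ⟨⟨e, ?_, ?_⟩, fun _ => rfl⟩
  · refine continuous_iff_continuousAt.2 fun x => Metric.tendsto_nhds.2 fun δ hδ => ?_
    have hlim := ((h.tendsto_real_closedBall hX x).rpow_const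
      (p := ε) (Or.inr hε.le)).const_mul A
    rw [Real.zero_rpow hε.ne', mul_zero] at hlim
    obtain ⟨r, hrδ, hr⟩ := ((hlim.eventually (gt_mem_nhds hδ)).and self_mem_nhdsWithin).exists
    filter_upwards [Metric.closedBall_mem_nhds x hr] with y hy
    rw [Metric.mem_closedBall'] at hy
    calc dist (e y) (e x) = dist (e x) (e y) := dist_comm _ _
      _ ≤ A * μ.real (Metric.closedBall x (dist x y)) ^ ε := hup x y
      _ ≤ A * μ.real (Metric.closedBall x r) ^ ε := by
          have := h.real_mono (Metric.closedBall_subset_closedBall (x := x) hy)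
          gcongr
      _ < δ := hrδ
  · refine continuous_iff_continuousAt.2 fun y => Metric.tendsto_nhds.2 fun r hr => ?_
    obtain ⟨x, rfl⟩ := e.surjective y
    have hpos : 0 < μ.real (Metric.closedBall x r) ^ ε := Real.rpow_pos_of_pos (h.pos x hr) ε
    filter_upwards [Metric.ball_mem_nhds (e x) (div_pos hpos (zero_lt_one.trans_le hA))] with y hy
    obtain ⟨w, rfl⟩ := e.surjective y
    rw [Metric.mem_ball', lt_div_iff₀ (by linarith)] at hy
    change dist (e.symm (e w)) (e.symm (e x)) < r
    rw [e.symm_apply_apply, e.symm_apply_apply, dist_comm]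
    by_contra hw
    have h1 : μ.real (Metric.closedBall x r) ^ ε ≤
        μ.real (Metric.closedBall x (dist x w)) ^ ε :=
      Real.rpow_le_rpow measureReal_nonneg
        (h.real_mono (Metric.closedBall_subset_closedBall (not_lt.1 hw))) hε.le
    linarith [hlow x w]

theorem isQuasisymmetric [MetricSpace Y] (h : IsDoublingWith μ C)
    (hX : IsUniformlyPerfect X) (f : X ≃ₜ Y) (hε : 0 < ε) (hA : 1 ≤ A)
    (hlow : ∀ x y : X,
      μ.real (Metric.closedBall x (dist x y)) ^ ε ≤ A * dist (f x) (f y))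
    (hup : ∀ x y : X,
      dist (f x) (f y) ≤ A * μ.real (Metric.closedBall x (dist x y)) ^ ε) :
    IsQuasisymmetric f := by
  obtain ⟨a, b, K, ha, hb, hK, hgrow⟩ := h.exists_growth_decay hX
  have hA0 : 0 < A := by linarith
  lift A to ℝ≥0 using hA0.le
  lift K to ℝ≥0 using hK.le
  have hA' : 0 < A := by exact_mod_cast hA0
  have hK' : 0 < K := by exact_mod_cast hK
  have hmono : StrictMono fun t : ℝ≥0 => A * A * (K * (t ^ a + t ^ b)) ^ ε := by
    intro s t hst
    have h1 := NNReal.rpow_lt_rpow hst ha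
    have h2 := NNReal.rpow_lt_rpow hst hb
    have h3 := NNReal.rpow_lt_rpow
      (mul_lt_mul_of_pos_left (add_lt_add h1 h2) hK') hε
    exact mul_lt_mul_of_pos_left h3 (mul_pos hA' hA')
  have hcont : Continuous fun t : ℝ≥0 => A * A * (K * (t ^ a + t ^ b)) ^ ε :=
    continuous_const.mul ((NNReal.continuous_rpow_const hε.le).comp (continuous_const.mul
      ((NNReal.continuous_rpow_const ha.le).add (NNReal.continuous_rpow_const hb.le))))
  have htop : Filter.Tendsto (fun t : ℝ≥0 => A * A * (K * (t ^ a + t ^ b)) ^ ε)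
      Filter.atTop Filter.atTop := by
    have h1 : Filter.Tendsto (fun t : ℝ≥0 => t ^ a + t ^ b) Filter.atTop Filter.atTop :=
      Filter.tendsto_atTop_mono (fun t => le_add_of_nonneg_right zero_le)
        (NNReal.tendsto_rpow_atTop ha)
    exact ((NNReal.tendsto_rpow_atTop hε).comp (h1.const_mul_atTop hK')).const_mul_atTop
      (mul_pos hA' hA')
  obtain ⟨η, hη⟩ := NNReal.exists_homeomorph_eq hmono hcont
    (by simp [NNReal.zero_rpow, ha.ne', hb.ne', hε.ne']) htop
  refine ⟨η, fun x y z hxy _ hxz => ?_⟩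
  rw [hη, ← NNReal.coe_le_coe]
  push_cast
  have hd : 0 < dist x z := dist_pos.2 hxz
  have hfd : 0 < dist (f x) (f z) := dist_pos.2 (f.injective.ne hxz)
  rw [div_le_iff₀ hfd]
  have ht : 0 < dist x y / dist x z := div_pos (dist_pos.2 hxy) hd
  have h1 := hgrow x z (dist x y / dist x z) hxz ht
  rw [div_mul_cancel₀ _ hd.ne'] at h1
  set t := dist x y / dist x z
  calc dist (f x) (f y) ≤ A * μ.real (Metric.closedBall x (dist x y)) ^ ε := hup x y
    _ ≤ A * (K * (t ^ a + t ^ b) * μ.real (Metric.closedBall x (dist x z))) ^ ε := by gcongr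
    _ = A * (K * (t ^ a + t ^ b)) ^ ε * μ.real (Metric.closedBall x (dist x z)) ^ ε := by
        rw [Real.mul_rpow (by positivity) measureReal_nonneg, mul_assoc]
    _ ≤ A * (K * (t ^ a + t ^ b)) ^ ε * (A * dist (f x) (f z)) := by
        gcongr
        exact hlow x z
    _ = A * A * (K * (t ^ a + t ^ b)) ^ ε * dist (f x) (f z) := by ring

/-- Balls of radius `s` in the associated metric have `μ`-measure at most a multiple of
`s ^ (1 / ε)`: a bounded part of such a ball is contained in a ball of `X` whose radius is at most
twice the distance from the centre to one of its points. -/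
theorem measure_preimage_closedBall_le [Nontrivial X] [MetricSpace Y] (h : IsDoublingWith μ C)
    (hX : IsUniformlyPerfect X) (f : X ≃ₜ Y) (hε : 0 < ε) (hA : 1 ≤ A)
    (hlow : ∀ x y : X,
      μ.real (Metric.closedBall x (dist x y)) ^ ε ≤ A * dist (f x) (f y))
    (x : X) {s : ℝ} (hs : 0 < s) :
    μ (f ⁻¹' Metric.closedBall (f x) s) ≤ ENNReal.ofReal (C * (A * s) ^ ε⁻¹) := by
  have hC := h.one_le
  set S := f ⁻¹' Metric.closedBall (f x) s with hS
  have hSle : ∀ w ∈ S, μ.real (Metric.closedBall x (dist x w)) ≤ (A * s) ^ ε⁻¹ := by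
    intro w hw
    rw [hS, Set.mem_preimage, Metric.mem_closedBall'] at hw
    rw [Real.le_rpow_inv_iff_of_pos measureReal_nonneg (by positivity) hε]
    exact (hlow x w).trans (by gcongr)
  have hpart : ∀ n : ℕ, μ (S ∩ Metric.closedBall x n) ≤
      ENNReal.ofReal (C * (A * s) ^ ε⁻¹) := by
    intro n
    set T := S ∩ Metric.closedBall x n with hT
    by_cases hTx : T ⊆ Metric.closedBall x 0
    · refine (measure_mono hTx).trans ?_
      have := (measureReal_eq_zero_iff (h.ne_top x 0)).1 (h.real_closedBall_zero hX x)
      rw [this]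
      exact zero_le
    · obtain ⟨w₀, hw₀, hw₀x⟩ := Set.not_subset.1 hTx
      rw [Metric.mem_closedBall', not_le] at hw₀x
      have hbdd : BddAbove (dist x '' T) := by
        refine ⟨n, ?_⟩
        rintro _ ⟨w, hw, rfl⟩
        exact Metric.mem_closedBall'.1 hw.2
      have hsup := le_csSup hbdd (Set.mem_image_of_mem _ hw₀)
      obtain ⟨_, ⟨w, hw, rfl⟩, hwR⟩ := exists_lt_of_lt_csSup ⟨_, Set.mem_image_of_mem (dist x) hw₀⟩
        (half_lt_self (hw₀x.trans_le hsup))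
      have hwpos : 0 < dist x w := by linarith
      calc μ T ≤ μ (Metric.closedBall x (2 * dist x w)) := by
            refine measure_mono fun v hv => ?_
            rw [Metric.mem_closedBall']
            linarith [le_csSup hbdd (Set.mem_image_of_mem (dist x) hv)]
        _ = ENNReal.ofReal (μ.real (Metric.closedBall x (2 * dist x w))) :=
            (ofReal_measureReal (h.ne_top _ _)).symm
        _ ≤ ENNReal.ofReal (C * (A * s) ^ ε⁻¹) := by
            refine ENNReal.ofReal_le_ofReal ((h.doubling x hwpos).trans ?_)
            gcongr
            exact hSle w hw.1
  have hunion : S = ⋃ n : ℕ, S ∩ Metric.closedBall x n := by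
    rw [← Set.inter_iUnion, Metric.iUnion_closedBall_nat, Set.inter_univ]
  have hmono : Monotone fun n : ℕ => S ∩ Metric.closedBall x n := fun m n hmn =>
    Set.inter_subset_inter_right _ (Metric.closedBall_subset_closedBall (by exact_mod_cast hmn))
  rw [hunion, hmono.measure_iUnion]
  exact iSup_le hpart

/-- Balls of radius `s ≤ diam Y` in the associated metric have `μ`-measure at least a multiple of
`s ^ (1 / ε)`: start from a ball of `X` whose measure is at least that large, and halve the radius
until the ball is contained in the given one. -/
theorem le_measure_preimage_closedBall [Nontrivial X] [MetricSpace Y] (h : IsDoublingWith μ C)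
    (hX : IsUniformlyPerfect X) (f : X ≃ₜ Y) (hε : 0 < ε) (hA : 1 ≤ A)
    (hup : ∀ x y : X,
      dist (f x) (f y) ≤ A * μ.real (Metric.closedBall x (dist x y)) ^ ε)
    (x : X) {s : ℝ} (hs : 0 < s) (hdiam : ENNReal.ofReal s ≤ Metric.ediam (Set.univ : Set Y)) :
    ENNReal.ofReal (C⁻¹ * (s / (3 * A)) ^ ε⁻¹) ≤ μ (f ⁻¹' Metric.closedBall (f x) s) := by
  have hC := h.one_le
  obtain ⟨z, hz⟩ : ∃ z, s / 3 < dist (f x) (f z) := by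
    by_contra! hcon
    have : Metric.ediam (Set.univ : Set Y) ≤ ENNReal.ofReal (2 * s / 3) := by
      refine Metric.ediam_le fun v _ w _ => ?_
      obtain ⟨v, rfl⟩ := f.surjective v
      obtain ⟨w, rfl⟩ := f.surjective w
      rw [edist_dist]
      refine ENNReal.ofReal_le_ofReal ?_
      linarith [dist_triangle_left (f v) (f w) (f x), hcon v, hcon w]
    have h1 := (ENNReal.ofReal_le_ofReal_iff (by positivity)).1 (hdiam.trans this)
    linarith
  have hxz : x ≠ z := by
    rintro rfl
    rw [dist_self] at hz
    linarith
  have hd : 0 < dist x z := dist_pos.2 hxz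
  have hsmall : ∃ n : ℕ,
      A * μ.real (Metric.closedBall x (dist x z * (1 / 2) ^ n)) ^ ε ≤ s := by
    have h1 : Filter.Tendsto (fun n : ℕ => dist x z * (1 / 2 : ℝ) ^ n) Filter.atTop
        (nhdsWithin 0 (Set.Ioi 0)) := by
      refine tendsto_nhdsWithin_iff.2
        ⟨?_, Filter.Eventually.of_forall fun n => Set.mem_Ioi.2 (by positivity)⟩
      simpa using (tendsto_pow_atTop_nhds_zero_of_lt_one (r := (1 / 2 : ℝ)) (by norm_num)
        (by norm_num)).const_mul (dist x z)
    have h2 := (((h.tendsto_real_closedBall hX x).comp h1).rpow_const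
      (p := ε) (Or.inr hε.le)).const_mul A
    rw [Real.zero_rpow hε.ne', mul_zero] at h2
    obtain ⟨n, hn⟩ := (h2.eventually (gt_mem_nhds hs)).exists
    exact ⟨n, hn.le⟩
  -- A lower bound for the measure of a ball follows from one for its `ε`-th power.
  have hconv : ∀ m : ℝ, 0 ≤ m → s / 3 ≤ A * m ^ ε → (s / (3 * A)) ^ ε⁻¹ ≤ m := by
    intro m hm hle
    rw [Real.rpow_inv_le_iff_of_pos (by positivity) hm hε, div_le_iff₀ (by positivity)]
    linarith
  classical
  obtain ⟨n, hn, hmin⟩ : ∃ n : ℕ,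
      A * μ.real (Metric.closedBall x (dist x z * (1 / 2) ^ n)) ^ ε ≤ s ∧
      ∀ k < n, s < A * μ.real (Metric.closedBall x (dist x z * (1 / 2) ^ k)) ^ ε :=
    ⟨Nat.find hsmall, Nat.find_spec hsmall, fun k hk => not_le.1 (Nat.find_min hsmall hk)⟩
  have hlower : C⁻¹ * (s / (3 * A)) ^ ε⁻¹ ≤
      μ.real (Metric.closedBall x (dist x z * (1 / 2) ^ n)) := by
    rw [inv_mul_le_iff₀ (by positivity)]
    cases n with
    | zero =>
      rw [pow_zero, mul_one]
      exact (hconv _ measureReal_nonneg (hz.le.trans (hup x z))).trans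
        (le_mul_of_one_le_left measureReal_nonneg hC)
    | succ k =>
      have h1 := h.doubling x (r := dist x z * (1 / 2) ^ (k + 1)) (by positivity)
      rw [show 2 * (dist x z * (1 / 2) ^ (k + 1)) = dist x z * (1 / 2) ^ k by ring] at h1
      exact (hconv _ measureReal_nonneg (by linarith [hmin k (Nat.lt_succ_self k)])).trans h1
  calc ENNReal.ofReal (C⁻¹ * (s / (3 * A)) ^ ε⁻¹)
      ≤ ENNReal.ofReal (μ.real (Metric.closedBall x (dist x z * (1 / 2) ^ n))) :=
        ENNReal.ofReal_le_ofReal hlower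
    _ = μ (Metric.closedBall x (dist x z * (1 / 2) ^ n)) := ofReal_measureReal (h.ne_top _ _)
    _ ≤ μ (f ⁻¹' Metric.closedBall (f x) s) := by
        refine measure_mono fun w hw => ?_
        rw [Metric.mem_closedBall'] at hw
        rw [Set.mem_preimage, Metric.mem_closedBall']
        refine (hup x w).trans (le_trans ?_ hn)
        have := h.real_mono (Metric.closedBall_subset_closedBall (x := x) hw)
        gcongr

theorem isAhlforsMeasure_map [Nontrivial X] [MetricSpace Y] [MeasurableSpace Y] [BorelSpace Y]
    (h : IsDoublingWith μ C) (hX : IsUniformlyPerfect X) (f : X ≃ₜ Y) (hε : 0 < ε) (hA : 1 ≤ A)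
    (hlow : ∀ x y : X,
      μ.real (Metric.closedBall x (dist x y)) ^ ε ≤ A * dist (f x) (f y))
    (hup : ∀ x y : X,
      dist (f x) (f y) ≤ A * μ.real (Metric.closedBall x (dist x y)) ^ ε) :
    IsAhlforsMeasure (μ.map f) ε⁻¹ (C * (3 * A) ^ ε⁻¹) := by
  have hC := h.one_le
  intro y s hs hdiam
  obtain ⟨x, rfl⟩ := f.surjective y
  rw [Measure.map_apply f.continuous.measurable Metric.isClosed_closedBall.measurableSet]
  constructor
  · convert h.le_measure_preimage_closedBall hX f hε hA hup x hs hdiam using 2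
    rw [Real.div_rpow hs.le (by positivity), mul_inv]
    ring
  · refine (h.measure_preimage_closedBall_le hX f hε hA hlow x hs).trans
      (ENNReal.ofReal_le_ofReal ?_)
    rw [mul_assoc, ← Real.mul_rpow (by positivity) hs.le]
    gcongr
    linarith

end IsDoublingWith

/-- Every doubling measure on a uniformly perfect space becomes a regular measure after a
quasisymmetric change of the metric. -/
theorem IsDoublingMeasure.exists_isAhlforsMeasure {X : Type u} [MetricSpace X] [MeasurableSpace X]
    [BorelSpace X] [Nontrivial X] (hX : IsUniformlyPerfect X) {μ : Measure X}
    (hμ : IsDoublingMeasure μ) :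
    ∃ (Y : Type u) (_ : MetricSpace Y) (_ : MeasurableSpace Y) (_ : BorelSpace Y) (f : X ≃ₜ Y)
      (ν : Measure Y) (q C : ℝ), 0 < q ∧ 1 ≤ C ∧ IsAhlforsMeasure ν q C ∧ IsQuasisymmetric f ∧
        ∀ A : Set X, ν (f '' A) = μ A := by
  obtain ⟨C, h⟩ := hμ.exists_isDoublingWith
  obtain ⟨Y, hY, e, ε, A, hε, hA, hbounds⟩ := h.exists_metricSpace (h.real_closedBall_zero hX)
  obtain ⟨f, hf⟩ := h.exists_homeomorph hX e hε hA (fun x y => (hbounds x y).1)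
    (fun x y => (hbounds x y).2)
  simp only [← hf] at hbounds
  let _ : MeasurableSpace Y := borel Y
  have : BorelSpace Y := ⟨rfl⟩
  refine ⟨Y, hY, borel Y, ⟨rfl⟩, f, μ.map f, ε⁻¹, C * (3 * A) ^ ε⁻¹, by positivity,
    one_le_mul_of_one_le_of_one_le h.one_le (Real.one_le_rpow (by linarith) (by positivity)),
    h.isAhlforsMeasure_map hX f hε hA (fun x y => (hbounds x y).1) (fun x y => (hbounds x y).2),
    h.isQuasisymmetric hX f hε hA (fun x y => (hbounds x y).1) (fun x y => (hbounds x y).2),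
    fun E => ?_⟩
  have := f.toMeasurableEquiv.map_apply (μ := μ) (f '' E)
  rw [Homeomorph.toMeasurableEquiv_coe, Set.preimage_image_eq _ f.injective] at this
  exact this

/-! ### Fat and thin sets -/

theorem isFat_iff_of_nontrivial {X : Type u} [MetricSpace X] [MeasurableSpace X] [BorelSpace X]
    [Nontrivial X] (hX : IsUniformlyPerfect X) (E : Set X) :
    IsFat E ↔ IsQuasisymmetricallyThick E := by
  constructor
  · intro hE Y _ _ _ q f hq ⟨ν, C, hC, hν⟩ hf
    have : Nontrivial Y := f.injective.nontrivial
    have hν' : IsAhlforsMeasure ν q C := hν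
    have h1 := hE _ (hν'.isDoublingMeasure_map_symm hX hf hq hC)
    rw [Homeomorph.map_symm_apply] at h1
    rw [pos_iff_ne_zero] at h1 ⊢
    rwa [Ne, hν'.hausdorffMeasure_eq_zero_iff hq hC]
  · intro hE μ hμ
    obtain ⟨Y, _, _, _, f, ν, q, C, hq, hC, hν, hf, hE'⟩ := hμ.exists_isAhlforsMeasure hX
    have : Nontrivial Y := f.injective.nontrivial
    have h1 := hE Y q f hq ⟨ν, C, hC, hν⟩ hf
    rw [pos_iff_ne_zero] at h1 ⊢
    rwa [Ne, hν.hausdorffMeasure_eq_zero_iff hq hC, hE'] at h1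

theorem isThin_iff_of_nontrivial {X : Type u} [MetricSpace X] [MeasurableSpace X] [BorelSpace X]
    [Nontrivial X] (hX : IsUniformlyPerfect X) (E : Set X) :
    IsThin E ↔ IsQuasisymmetricallyNull E := by
  constructor
  · intro hE Y _ _ _ q f hq ⟨ν, C, hC, hν⟩ hf
    have : Nontrivial Y := f.injective.nontrivial
    have hν' : IsAhlforsMeasure ν q C := hν
    have h1 := hE _ (hν'.isDoublingMeasure_map_symm hX hf hq hC)
    rw [Homeomorph.map_symm_apply] at h1
    rwa [hν'.hausdorffMeasure_eq_zero_iff hq hC]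
  · intro hE μ hμ
    obtain ⟨Y, _, _, _, f, ν, q, C, hq, hC, hν, hf, hE'⟩ := hμ.exists_isAhlforsMeasure hX
    have : Nontrivial Y := f.injective.nontrivial
    have h1 := hE Y q f hq ⟨ν, C, hC, hν⟩ hf
    rwa [hν.hausdorffMeasure_eq_zero_iff hq hC, hE'] at h1

/-- The empty set is not fat in the empty space, where the zero measure is doubling, and it is not
quasisymmetrically thick either, because the empty space is regular. -/
theorem isFat_iff_of_isEmpty {X : Type u} [MetricSpace X] [MeasurableSpace X] [BorelSpace X]
    [IsEmpty X] (E : Set X) : IsFat E ↔ IsQuasisymmetricallyThick E := by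
  have hE : E = ∅ := Set.eq_empty_of_isEmpty E
  refine iff_of_false (fun h => ?_) fun h => ?_
  · simpa [hE] using h 0 ⟨1, le_rfl, fun x => isEmptyElim x⟩
  · simpa [hE] using h X 1 (Homeomorph.refl X) one_pos ⟨0, 1, le_rfl, fun x => isEmptyElim x⟩
      ⟨Homeomorph.refl _, fun x => isEmptyElim x⟩

theorem proposition1p2 {X : Type u} [MetricSpace X] [MeasurableSpace X] [BorelSpace X]
    (hX : IsUniformlyPerfect X) (E : Set X) :
    (IsFat E ↔ IsQuasisymmetricallyThick E) ∧ (IsThin E ↔ IsQuasisymmetricallyNull E) := by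
  rcases isEmpty_or_nonempty X with hempty | ⟨⟨x⟩⟩
  · refine ⟨isFat_iff_of_isEmpty E, iff_of_true ?_ ?_⟩
    · intro μ _
      rw [Set.eq_empty_of_isEmpty E, measure_empty]
    · intro Y _ _ _ q f _ _ _
      rw [Set.eq_empty_of_isEmpty E, Set.image_empty, measure_empty]
  · have : Nontrivial X := by
      by_contra hn
      rw [not_nontrivial_iff_subsingleton] at hn
      exact hX.1 ⟨x, Set.eq_singleton_iff_unique_mem.2 ⟨trivial, fun y _ => Subsingleton.elim y x⟩⟩
    exact ⟨isFat_iff_of_nontrivial hX E, isThin_iff_of_nontrivial hX E⟩
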